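/- Let $S=\begin{pmatrix}A&B\\ C&D\end{pmatrix}\in\mathrm{Sp}(d,\mathbb R)$ be a symplectic matrix with blocks $A,B,C,D\in\mathbb R^{d\times d}$, and let $\hat S$ be a metaplectic operator with projection $S$, i.e. a unitary operator on $L^2(\mathbb R^d)$ such that $W(\hat Sf,\hat Sg)(z)=W(f,g)(S^{-1}z)$ for all $f,g\in L^2(\mathbb R^d)$ and $z\in\mathbb R^{2d}$, where $$W(f,g)(x,\xi)=\int_{\mathbb R^d}f\left(x+\tfrac t2\right)\overline{g\left(x-\tfrac t2\right)}\,e^{-2\pi i\xi\cdot t}\,dt .$$ Assume that $1\le r=\operatorname{rank}B<d$, and write $R(B)$ for the range of $B$. Then $$\mathbb R^d=\ker(B)^\perp\oplus D^T(R(B)^\perp)=R(B)\oplus R(B)^\perp,$$ and $D^T$ is injective on $R(B)^\perp$. Write $x=x_1+x_2$ with $x_1\in\ker(B)^\perp$, $x_2\in D^T(R(B)^\perp)$, write $\xi=\xi_1+\xi_2$ with $\xi_1\in R(B)$, $\xi_2\in R(B)^\perp$, and let $D^{-T}$ denote the inverse of $D^T|_{R(B)^\perp}$. For every compact set $K\subseteq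 D^T(R(B)^\perp)$ there is a function $f\in L^2(\mathbb R^d)$ such that $$\operatorname{supp}(f)\subseteq\{x: x_2\in K\},\qquad \operatorname{supp}(\hat Sf)\subseteq\{\xi:\xi_2\in D^{-T}(K)\},$$ and $f\neq0$ whenever $K$ has positive $(d-r)$-dimensional Lebesgue measure in $D^T(R(B)^\perp)$. Here $\operatorname{supp}$ is the essential support: the complement of the largest open set on which the function vanishes almost everywhere. -/

import Mathlib

open MeasureTheory

noncomputable section

/-- `ℝᵈ` with the Euclidean norm. -/
abbrev RSpace (d : ℕ) : Type := EuclideanSpace ℝ (Fin d)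

/-- `L²(ℝᵈ)`, complex valued, with respect to Lebesgue measure. -/
abbrev L2Space (d : ℕ) : Type := Lp ℂ 2 (volume : Measure (RSpace d))

/-- The action `z ↦ T z` of a real `2d × 2d` matrix on phase space `ℝᵈ × ℝᵈ`. -/
def phaseSpaceMap {d : ℕ} (T : Matrix (Fin d ⊕ Fin d) (Fin d ⊕ Fin d) ℝ)
    (z : RSpace d × RSpace d) : RSpace d × RSpace d :=
  (WithLp.toLp 2 (fun i => T.mulVec (Sum.elim z.1.ofLp z.2.ofLp) (Sum.inl i)),
   WithLp.toLp 2 (fun i => T.mulVec (Sum.elim z.1.ofLp z.2.ofLp) (Sum.inr i)))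

/-- The cross-Wigner distribution
`W(f,g)(x,ξ) = ∫ f(x + t/2) conj(g(x - t/2)) exp(-2πi ξ·t) dt`. -/
def crossWigner {d : ℕ} (f g : RSpace d → ℂ) (z : RSpace d × RSpace d) : ℂ :=
  ∫ t : RSpace d,
    f (z.1 + (1 / 2 : ℝ) • t) * (starRingEnd ℂ) (g (z.1 - (1 / 2 : ℝ) • t)) *
      Complex.exp (-(2 * (Real.pi : ℂ) * Complex.I * ((inner ℝ z.2 t : ℝ) : ℂ)))

/-- The unitary operator `U` on `L²(ℝᵈ)` is a metaplectic operator with projection `S`: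
`W(Uf,Ug)(z) = W(f,g)(S⁻¹ z)` for all `f, g ∈ L²(ℝᵈ)` and all `z ∈ ℝ²ᵈ`. -/
def IsMetaplectic {d : ℕ} (S : Matrix (Fin d ⊕ Fin d) (Fin d ⊕ Fin d) ℝ)
    (U : L2Space d ≃ₗᵢ[ℂ] L2Space d) : Prop :=
  S ∈ Matrix.symplecticGroup (Fin d) ℝ ∧
    ∀ (f g : L2Space d) (z : RSpace d × RSpace d),
      crossWigner (U f) (U g) z = crossWigner f g (phaseSpaceMap S⁻¹ z)

/-- The (essential) support of an `L²` function: a point lies outside it exactly when the function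
vanishes almost everywhere on some neighbourhood of the point. -/
def essSupport {d : ℕ} (f : L2Space d) : Set (RSpace d) :=
  {x | ∀ V ∈ nhds x, ¬ ∀ᵐ y ∂(volume.restrict V), f y = 0}

/-- The kernel of a matrix. -/
def matKer {d : ℕ} (B : Matrix (Fin d) (Fin d) ℝ) : Submodule ℝ (RSpace d) :=
  LinearMap.ker (Matrix.toEuclideanLin B)

/-- The range of a matrix. -/
def matRange {d : ℕ} (B : Matrix (Fin d) (Fin d) ℝ) : Submodule ℝ (RSpace d) :=
  LinearMap.range (Matrix.toEuclideanLin B)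

/-- The subspace `Dᵀ(R(B)^⊥)`. -/
def transComplement {d : ℕ} (B D : Matrix (Fin d) (Fin d) ℝ) : Submodule ℝ (RSpace d) :=
  (matRange B)ᗮ.map (Matrix.toEuclideanLin D.transpose)

/-- `D^{-T}(K)`, the image of `K ⊆ Dᵀ(R(B)^⊥)` under the inverse of `Dᵀ` restricted
to `R(B)^⊥`. -/
def transPreimage {d : ℕ} (B D : Matrix (Fin d) (Fin d) ℝ) (K : Set (RSpace d)) :
    Set (RSpace d) :=
  {y | y ∈ (matRange B)ᗮ ∧ Matrix.toEuclideanLin D.transpose y ∈ K}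

/-- The cylinder of all `x = x₁ + x₂` with `x₁ ∈ L` and `x₂ ∈ K`. When `ℝᵈ = L ⊕ L'` and
`K ⊆ L'`, this is the set of all `x` whose `L'`-component lies in `K`. -/
def cylinderOver {d : ℕ} (L : Submodule ℝ (RSpace d)) (K : Set (RSpace d)) : Set (RSpace d) :=
  {x | ∃ x₁ ∈ L, ∃ x₂ ∈ K, x = x₁ + x₂}

/-- Lebesgue measure of a linear subspace with its inherited Euclidean structure: the translation
invariant measure giving mass one to the cube spanned by an orthonormal basis. (The instance
`volume` on the subtype would be the restriction of `d`-dimensional Lebesgue measure instead.) -/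
def subspaceLebesgue {d : ℕ} (L : Submodule ℝ (RSpace d)) : Measure L :=
  (stdOrthonormalBasis ℝ L).toBasis.addHaar

end

/-! ### Block identities and the two decompositions -/

section LinearAlgebra

open Matrix

variable {d : ℕ} {A B C D : Matrix (Fin d) (Fin d) ℝ}

/-! The position part of `S⁻¹ (x, ξ)` is `Dᵀ x - Bᵀ ξ`. The projection `P` onto `Dᵀ(R(B)^⊥)` along
`ker(B)^⊥ = R(Bᵀ)` kills `Bᵀ ξ`, so `P` of that position does not depend on `ξ`. If `f` lives where
`P x` lies in a convex set `E`, then `W(f,f)` vanishes at positions outside `P⁻¹(E)`. Hence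
`W(Uf,Uf)(m, ξ) = 0` for every `ξ` once `P Dᵀ m ∉ E`, and `ae_eq_zero_of_crossWigner_eq_zero` turns
this into vanishing of `Uf` near such `m`. For compact `K`, linearity of `U` reduces to pieces of
`f` over small balls (`IsMetaplectic.ae_eq_zero_of_isCompact`). The indicator of a truncated
cylinder over `K` then serves as `f`. -/

theorem symplectic_block_mul_transpose
    (hS : fromBlocks A B C D ∈ symplecticGroup (Fin d) ℝ) :
    A * Bᵀ = B * Aᵀ ∧ A * Dᵀ - B * Cᵀ = 1 := by
  have h := SymplecticGroup.mem_iff.mp hS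
  rw [J, fromBlocks_transpose, fromBlocks_multiply, fromBlocks_multiply, fromBlocks_inj] at h
  obtain ⟨h1, h2, -, -⟩ := h
  simp only [Matrix.mul_zero, Matrix.mul_one, Matrix.mul_neg, zero_add, add_zero,
    Matrix.neg_mul] at h1 h2
  refine ⟨(sub_eq_zero.mp (by rw [sub_eq_add_neg]; exact h1)).symm, ?_⟩
  rw [← neg_inj, neg_sub, sub_eq_add_neg]
  exact h2

theorem symplectic_block_transpose_mul
    (hS : fromBlocks A B C D ∈ symplecticGroup (Fin d) ℝ) :
    Dᵀ * B = Bᵀ * D ∧ Dᵀ * A - Bᵀ * C = 1 := by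
  have h := SymplecticGroup.mem_iff'.mp hS
  rw [J, fromBlocks_transpose, fromBlocks_multiply, fromBlocks_multiply, fromBlocks_inj] at h
  obtain ⟨-, -, h1, h2⟩ := h
  simp only [Matrix.mul_zero, Matrix.mul_one, Matrix.mul_neg, zero_add, add_zero,
    Matrix.neg_mul] at h1 h2
  refine ⟨sub_eq_zero.mp (by rw [sub_eq_add_neg]; exact h2), ?_⟩
  rw [sub_eq_add_neg]
  exact h1

theorem toEuclideanLin_mul_apply (M N : Matrix (Fin d) (Fin d) ℝ) (x : RSpace d) :
    toEuclideanLin (M * N) x = toEuclideanLin M (toEuclideanLin N x) := by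
  simp [toLpLin_apply]

theorem fst_phaseSpaceMap_symplectic_inv
    (hS : fromBlocks A B C D ∈ symplecticGroup (Fin d) ℝ) (z : RSpace d × RSpace d) :
    (phaseSpaceMap (fromBlocks A B C D)⁻¹ z).1 =
      toEuclideanLin Dᵀ z.1 - toEuclideanLin Bᵀ z.2 := by
  have h : (fromBlocks A B C D)⁻¹ = fromBlocks Dᵀ (-Bᵀ) (-Cᵀ) Aᵀ := by
    rw [SymplecticGroup.inv_eq_symplectic_inv _ hS, J, fromBlocks_transpose, fromBlocks_neg,
      fromBlocks_multiply, fromBlocks_multiply]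
    simp
  ext i
  simp [phaseSpaceMap, h, fromBlocks_mulVec, toLpLin_apply, neg_mulVec, sub_eq_add_neg]

theorem orthogonal_matKer (B : Matrix (Fin d) (Fin d) ℝ) : (matKer B)ᗮ = matRange Bᵀ := by
  rw [matKer, LinearMap.orthogonal_ker, ← toEuclideanLin_conjTranspose_eq_adjoint,
    conjTranspose_eq_transpose_of_trivial, matRange]

/-- If `Dᵀ y = Bᵀ w`, then `y = A Dᵀ y - B Cᵀ y = A Bᵀ w - B Cᵀ y = B (Aᵀ w - Cᵀ y)`. -/
theorem mem_matRange_of_toEuclideanLin_transpose_mem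
    (hS : fromBlocks A B C D ∈ symplecticGroup (Fin d) ℝ) {y : RSpace d}
    (hy : toEuclideanLin Dᵀ y ∈ matRange Bᵀ) : y ∈ matRange B := by
  obtain ⟨h1, h2⟩ := symplectic_block_mul_transpose hS
  obtain ⟨w, hw⟩ := hy
  refine ⟨toEuclideanLin Aᵀ w - toEuclideanLin Cᵀ y, ?_⟩
  rw [map_sub, ← toEuclideanLin_mul_apply, ← h1, toEuclideanLin_mul_apply, hw,
    ← toEuclideanLin_mul_apply, ← toEuclideanLin_mul_apply, ← LinearMap.sub_apply, ← map_sub, h2]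
  simp

theorem toEuclideanLin_transpose_mem_of_mem_matRange
    (hS : fromBlocks A B C D ∈ symplecticGroup (Fin d) ℝ) {y : RSpace d}
    (hy : y ∈ matRange B) : toEuclideanLin Dᵀ y ∈ matRange Bᵀ := by
  obtain ⟨w, rfl⟩ := hy
  refine ⟨toEuclideanLin D w, ?_⟩
  rw [← toEuclideanLin_mul_apply, ← toEuclideanLin_mul_apply,
    (symplectic_block_transpose_mul hS).1]

theorem injOn_transpose_orthogonal_matRange
    (hS : fromBlocks A B C D ∈ symplecticGroup (Fin d) ℝ) :
    Set.InjOn (toEuclideanLin Dᵀ) ((matRange B)ᗮ : Set (RSpace d)) := by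
  intro x hx y hy hxy
  have hmem : x - y ∈ matRange B := by
    refine mem_matRange_of_toEuclideanLin_transpose_mem hS ?_
    rw [map_sub, hxy, sub_self]
    exact Submodule.zero_mem _
  have := (Submodule.orthogonal_disjoint (matRange B)).le_bot
    ⟨hmem, Submodule.sub_mem _ hx hy⟩
  exact sub_eq_zero.mp ((Submodule.mem_bot ℝ).mp this)

theorem isCompl_transComplement
    (hS : fromBlocks A B C D ∈ symplecticGroup (Fin d) ℝ) :
    IsCompl (matKer B)ᗮ (transComplement B D) := by
  rw [orthogonal_matKer]
  constructor
  · rw [Submodule.disjoint_def]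
    rintro _ hx ⟨y, hy, rfl⟩
    have := (Submodule.orthogonal_disjoint (matRange B)).le_bot
      ⟨mem_matRange_of_toEuclideanLin_transpose_mem hS hx, hy⟩
    rw [(Submodule.mem_bot ℝ).mp this, map_zero]
  · rw [codisjoint_iff, Submodule.eq_top_iff']
    intro x
    -- Use `x = Dᵀ A x - Bᵀ C x` and split `A x` along `R(B) ⊕ R(B)^⊥`; `Dᵀ` sends `R(B)` into
    -- `R(Bᵀ)`.
    obtain ⟨y₁, h₁, y₂, h₂, hsum⟩ := Submodule.exists_add_mem_mem_orthogonal (K := matRange B)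
      (toEuclideanLin A x)
    have hx : x = (toEuclideanLin Dᵀ y₁ - toEuclideanLin Bᵀ (toEuclideanLin C x)) +
        toEuclideanLin Dᵀ y₂ := by
      rw [sub_add_eq_add_sub, ← map_add, ← hsum, ← toEuclideanLin_mul_apply,
        ← toEuclideanLin_mul_apply, ← LinearMap.sub_apply, ← map_sub,
        (symplectic_block_transpose_mul hS).2]
      simp
    rw [hx]
    exact Submodule.add_mem_sup
      (Submodule.sub_mem _ (toEuclideanLin_transpose_mem_of_mem_matRange hS h₁) ⟨_, rfl⟩)
      (Submodule.mem_map_of_mem h₂)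

end LinearAlgebra

/-! ### Injectivity of the Fourier transform on integrable functions -/

section Fourier

open FourierTransform SchwartzMap

/-- Each test function is the transform of a Schwartz function, so moving the transform across the
pairing shows that `h` annihilates it. -/
theorem ae_eq_zero_of_fourier_eq_zero {d : ℕ} {h : RSpace d → ℂ} (hh : Integrable h)
    (hF : ∀ ξ, 𝓕 h ξ = 0) : ∀ᵐ t, h t = 0 := by
  refine ae_eq_zero_of_integral_contDiff_smul_eq_zero hh.locallyIntegrable ?_
  intro φ φ_smooth φ_cpt
  have hφ₁ : HasCompactSupport (Complex.ofRealCLM ∘ φ) := φ_cpt.comp_left rfl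
  have hφ₂ : ContDiff ℝ ((⊤ : ℕ∞) : WithTop ℕ∞) (Complex.ofRealCLM ∘ φ) := by fun_prop
  set ψ : 𝓢(RSpace d, ℂ) := hφ₁.toSchwartzMap hφ₂ with hψ
  have key : ∫ ξ, 𝓕 h ξ • (𝓕⁻ ψ : 𝓢(RSpace d, ℂ)) ξ = ∫ x, h x • 𝓕 (⇑(𝓕⁻ ψ : 𝓢(RSpace d, ℂ))) x := by
    simpa using! VectorFourier.integral_fourierIntegral_smul_eq_flip (L := innerₗ (RSpace d))
      Real.continuous_fourierChar continuous_inner hh (𝓕⁻ ψ : 𝓢(RSpace d, ℂ)).integrable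
  have hψ' : ∀ x, 𝓕 (⇑(𝓕⁻ ψ : 𝓢(RSpace d, ℂ))) x = φ x := by
    intro x
    rw [← SchwartzMap.fourier_coe, FourierTransform.fourier_fourierInv_eq]
    rfl
  simp only [hF, zero_smul, integral_zero, hψ'] at key
  rw [key]
  refine integral_congr_ae (Filter.Eventually.of_forall fun x => ?_)
  simp [mul_comm]

end Fourier

/-! ### Supports and the Wigner distribution -/

section Wigner

variable {d : ℕ}

theorem crossWigner_eq_fourier (f g : RSpace d → ℂ) (z : RSpace d × RSpace d) :
    crossWigner f g z = FourierTransform.fourier (fun t : RSpace d =>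
      f (z.1 + (1 / 2 : ℝ) • t) * (starRingEnd ℂ) (g (z.1 - (1 / 2 : ℝ) • t))) z.2 := by
  rw [Real.fourier_eq', crossWigner]
  refine integral_congr_ae (Filter.Eventually.of_forall fun t => ?_)
  simp only [smul_eq_mul]
  rw [mul_comm, real_inner_comm]
  congr 2
  push_cast
  ring

theorem quasiMeasurePreserving_add_smul (x : RSpace d) {r : ℝ} (hr : r ≠ 0) :
    Measure.QuasiMeasurePreserving (fun t : RSpace d => x + r • t) volume volume :=
  (measurePreserving_add_left volume x).quasiMeasurePreserving.comp
    (Measure.quasiMeasurePreserving_smul volume hr)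

theorem memLp_two_comp_add_smul {f : RSpace d → ℂ} (hf : MemLp f 2) (x : RSpace d) {r : ℝ}
    (hr : r ≠ 0) : MemLp (fun t => f (x + r • t)) 2 := by
  have hm : AEStronglyMeasurable (fun t => f (x + r • t)) :=
    hf.1.comp_quasiMeasurePreserving (quasiMeasurePreserving_add_smul x hr)
  rw [memLp_two_iff_integrable_sq_norm hm]
  have := (memLp_two_iff_integrable_sq_norm hf.1).mp hf
  exact (this.comp_add_left x).comp_smul hr

/-- If the Wigner distribution of `g` vanishes over a convex measurable set of positions, so does
`g`, up to a null set. -/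
theorem ae_eq_zero_of_crossWigner_eq_zero (g : L2Space d) {V : Set (RSpace d)}
    (hV : Convex ℝ V) (hVm : MeasurableSet V)
    (hW : ∀ m ∈ V, ∀ ξ, crossWigner g g (m, ξ) = 0) : ∀ᵐ x, x ∈ V → g x = 0 := by
  have hg : Measurable (g : RSpace d → ℂ) := (Lp.stronglyMeasurable g).measurable
  have hpair : ∀ m ∈ V, ∀ᵐ u, g u = 0 ∨ g ((2 : ℝ) • m - u) = 0 := by
    intro m hm
    have hint : Integrable (fun t : RSpace d =>
        g (m + (1 / 2 : ℝ) • t) * (starRingEnd ℂ) (g (m - (1 / 2 : ℝ) • t))) := by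
      have h := memLp_two_comp_add_smul (Lp.memLp g) m (r := -(1 / 2)) (by norm_num)
      simp only [neg_smul, ← sub_eq_add_neg] at h
      exact (memLp_two_comp_add_smul (Lp.memLp g) m (by norm_num)).integrable_mul (q := 2) h.star
    have h0 := ae_eq_zero_of_fourier_eq_zero hint fun ξ => by
      rw [← crossWigner_eq_fourier g g (m, ξ)]
      exact hW m hm ξ
    -- Substitute `t = 2u - 2m`, so that the two arguments become `u` and its reflection `2m - u`.
    have := (quasiMeasurePreserving_add_smul (-((2 : ℝ) • m)) (two_ne_zero' ℝ)).ae h0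
    filter_upwards [this] with u hu
    have e1 : m + (1 / 2 : ℝ) • (-((2 : ℝ) • m) + (2 : ℝ) • u) = u := by module
    have e2 : m - (1 / 2 : ℝ) • (-((2 : ℝ) • m) + (2 : ℝ) • u) = (2 : ℝ) • m - u := by module
    rw [e1, e2] at hu
    simpa using hu
  have hmeas : MeasurableSet {p : RSpace d × RSpace d |
      p.1 ∈ V → g p.2 = 0 ∨ g ((2 : ℝ) • p.1 - p.2) = 0} := by
    have h1 : MeasurableSet {p : RSpace d × RSpace d | p.1 ∈ V} := measurable_fst hVm
    have h2 : MeasurableSet {p : RSpace d × RSpace d | g p.2 = 0} :=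
      (hg.comp measurable_snd) (measurableSet_singleton 0)
    have h3 : MeasurableSet {p : RSpace d × RSpace d | g ((2 : ℝ) • p.1 - p.2) = 0} :=
      (hg.comp ((measurable_fst.const_smul (2 : ℝ)).sub measurable_snd))
        (measurableSet_singleton 0)
    exact h1.imp (h2.union h3)
  have hswap : ∀ᵐ u, ∀ᵐ m : RSpace d, m ∈ V → g u = 0 ∨ g ((2 : ℝ) • m - u) = 0 := by
    rw [← Measure.ae_ae_comm (p := fun m u : RSpace d =>
      m ∈ V → g u = 0 ∨ g ((2 : ℝ) • m - u) = 0) hmeas]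
    refine Filter.Eventually.of_forall fun m => ?_
    by_cases hm : m ∈ V
    · filter_upwards [hpair m hm] with u hu _ using hu
    · exact Filter.Eventually.of_forall fun u h => absurd h hm
  -- One good `u ∈ V` with `g u ≠ 0` suffices: for `v ∈ V` the midpoint `m = (u + v) / 2` is in `V`,
  -- forcing `g v = 0` for almost every such `v`. Without such a `u`, `g` vanishes a.e. on `V` by
  -- `hswap`.
  by_cases hex : ∃ u ∈ V, g u ≠ 0 ∧ ∀ᵐ m : RSpace d, m ∈ V → g u = 0 ∨ g ((2 : ℝ) • m - u) = 0
  · obtain ⟨u, huV, hu, hm⟩ := hex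
    have := (quasiMeasurePreserving_add_smul ((1 / 2 : ℝ) • u)
      (r := 1 / 2) (by norm_num)).ae hm
    filter_upwards [this] with v hv hvV
    have e : (2 : ℝ) • ((1 / 2 : ℝ) • u + (1 / 2 : ℝ) • v) - u = v := by module
    rw [e] at hv
    exact (hv (hV huV hvV (by norm_num) (by norm_num) (by norm_num))).resolve_left hu
  · filter_upwards [hswap] with u hu huV
    by_contra h
    exact hex ⟨u, huV, h, hu⟩

/-- The points `x ± t/2` have midpoint `x`, so a convex set missing `x` cannot contain both. -/
theorem crossWigner_self_eq_zero {g : RSpace d → ℂ} {E : Set (RSpace d)} (hE : Convex ℝ E)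
    (hg : ∀ᵐ x, x ∉ E → g x = 0) {z : RSpace d × RSpace d} (hz : z.1 ∉ E) :
    crossWigner g g z = 0 := by
  refine integral_eq_zero_of_ae ?_
  have h1 := (quasiMeasurePreserving_add_smul z.1 (r := 1 / 2) (by norm_num)).ae hg
  have h2 := (quasiMeasurePreserving_add_smul z.1 (r := -(1 / 2)) (by norm_num)).ae hg
  filter_upwards [h1, h2] with t h1 h2
  rw [neg_smul, ← sub_eq_add_neg] at h2
  by_cases hu : z.1 + (1 / 2 : ℝ) • t ∈ E
  · have hv : z.1 - (1 / 2 : ℝ) • t ∉ E := fun hv => hz <| by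
      have := hE hu hv (a := 1 / 2) (b := 1 / 2) (by norm_num) (by norm_num) (by norm_num)
      convert this using 1
      module
    simp only [h2 hv, map_zero, mul_zero, zero_mul, Pi.zero_apply]
  · simp only [h1 hu, zero_mul, Pi.zero_apply]

end Wigner

/-! ### Transfer of support through a metaplectic operator -/

section Metaplectic

variable {d : ℕ} {A B C D : Matrix (Fin d) (Fin d) ℝ} {U : L2Space d ≃ₗᵢ[ℂ] L2Space d}

/-- Splitting an `L²` function along a measurable set. -/
theorem exists_add_eq_indicator (g : L2Space d) {s : Set (RSpace d)} (hs : MeasurableSet s) :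
    ∃ g₁ g₂ : L2Space d, g = g₁ + g₂ ∧ (∀ᵐ x, g₁ x = s.indicator g x) ∧
      ∀ᵐ x, g₂ x = sᶜ.indicator g x := by
  have h1 := (Lp.memLp g).indicator hs
  have h2 := (Lp.memLp g).indicator hs.compl
  refine ⟨h1.toLp, h2.toLp, ?_, h1.coeFn_toLp, h2.coeFn_toLp⟩
  ext1
  filter_upwards [Lp.coeFn_add h1.toLp h2.toLp, h1.coeFn_toLp, h2.coeFn_toLp] with x h h1 h2
  rw [h, Pi.add_apply, h1, h2, Set.indicator_self_add_compl_apply]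

theorem IsMetaplectic.ae_eq_zero_of_convex (hU : IsMetaplectic (Matrix.fromBlocks A B C D) U)
    (P : RSpace d →ₗ[ℝ] RSpace d) (hP : ∀ y, P (Matrix.toEuclideanLin B.transpose y) = 0)
    {E V : Set (RSpace d)} (hE : Convex ℝ E) (hV : Convex ℝ V) (hVm : MeasurableSet V)
    (hVE : ∀ m ∈ V, P (Matrix.toEuclideanLin D.transpose m) ∉ E) {g : L2Space d}
    (hg : ∀ᵐ x, P x ∉ E → g x = 0) : ∀ᵐ x, x ∈ V → U g x = 0 := by
  refine ae_eq_zero_of_crossWigner_eq_zero (U g) hV hVm fun m hm ξ => ?_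
  rw [hU.2]
  refine crossWigner_self_eq_zero (hE.linear_preimage P) hg ?_
  rw [fst_phaseSpaceMap_symplectic_inv hU.1, Set.mem_preimage, map_sub, hP, sub_zero]
  exact hVE m hm

theorem IsMetaplectic.ae_eq_zero_of_isCompact
    (hU : IsMetaplectic (Matrix.fromBlocks A B C D) U)
    (P : RSpace d →ₗ[ℝ] RSpace d) (hP : ∀ y, P (Matrix.toEuclideanLin B.transpose y) = 0)
    {K V : Set (RSpace d)} (hK : IsCompact K) (hV : Convex ℝ V) (hVm : MeasurableSet V)
    {k₀ : RSpace d} {δ : ℝ} (hδ : 0 < δ) (hk₀ : ∀ k ∈ K, 2 * δ ≤ dist k k₀)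
    (hVδ : ∀ m ∈ V, dist (P (Matrix.toEuclideanLin D.transpose m)) k₀ < δ) {g : L2Space d}
    (hg : ∀ᵐ x, P x ∉ K → g x = 0) : ∀ᵐ x, x ∈ V → U g x = 0 := by
  have hPm : Measurable P := P.continuous_of_finiteDimensional.measurable
  -- Compactness induction removes convexity. The measurable superset `s` allows splitting `g` over
  -- a union, since the sets in the induction are arbitrary.
  have main : ∃ s, K ⊆ s ∧ MeasurableSet s ∧ ∀ g : L2Space d, (∀ᵐ x, P x ∉ s → g x = 0) →
      ∀ᵐ x, x ∈ V → U g x = 0 := by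
    refine hK.induction_on (p := fun t => ∃ s, t ⊆ s ∧ MeasurableSet s ∧ ∀ g : L2Space d,
      (∀ᵐ x, P x ∉ s → g x = 0) → ∀ᵐ x, x ∈ V → U g x = 0) ?_ ?_ ?_ ?_
    · refine ⟨∅, subset_rfl, MeasurableSet.empty, fun g hg => ?_⟩
      exact hU.ae_eq_zero_of_convex P hP convex_empty hV hVm (fun _ _ => Set.notMem_empty _) hg
    · rintro t t' htt' ⟨s, hs, h⟩
      exact ⟨s, htt'.trans hs, h⟩
    · rintro t t' ⟨s, hts, hs, h⟩ ⟨s', hts', hs', h'⟩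
      refine ⟨s ∪ s', Set.union_subset_union hts hts', hs.union hs', fun g hg => ?_⟩
      obtain ⟨g₁, g₂, rfl, h₁, h₂⟩ := exists_add_eq_indicator g (hPm hs)
      have k₁ := h g₁ <| by
        filter_upwards [h₁] with x hx hxs
        rw [hx, Set.indicator_of_notMem (Set.mem_preimage.not.mpr hxs)]
      have k₂ := h' g₂ <| by
        filter_upwards [h₂, hg] with x hx hgx hxs
        by_cases hxs' : P x ∈ s
        · rw [hx, Set.indicator_of_notMem (show x ∉ (P ⁻¹' s)ᶜ from not_not.mpr hxs')]
        · rw [hx, Set.indicator_of_mem (show x ∈ (P ⁻¹' s)ᶜ from hxs')]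
          exact hgx fun hc => hc.elim hxs' hxs
      rw [map_add]
      filter_upwards [k₁, k₂, Lp.coeFn_add (U g₁) (U g₂)] with x k₁ k₂ k hxV
      rw [k, Pi.add_apply, k₁ hxV, k₂ hxV, add_zero]
    · intro k hk
      -- This ball is convex and, as `dist k k₀ ≥ 2δ`, disjoint from the `δ`-ball about `k₀` that
      -- contains `P Dᵀ V`.
      refine ⟨Metric.ball k δ, mem_nhdsWithin_of_mem_nhds (Metric.ball_mem_nhds k hδ),
        Metric.ball k δ, subset_rfl, measurableSet_ball, fun g hg => ?_⟩
      refine hU.ae_eq_zero_of_convex P hP (convex_ball k δ) hV hVm (fun m hm hmk => ?_) hg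
      have := hk₀ k hk
      have := hVδ m hm
      have := Metric.mem_ball.mp hmk
      have := dist_triangle_left k k₀ (P (Matrix.toEuclideanLin D.transpose m))
      linarith
  obtain ⟨s, hKs, -, h⟩ := main
  refine h g ?_
  filter_upwards [hg] with x hx hxs using hx fun hc => hxs (hKs hc)

theorem IsMetaplectic.essSupport_subset (hU : IsMetaplectic (Matrix.fromBlocks A B C D) U)
    {P : RSpace d →ₗ[ℝ] RSpace d} (hP : ∀ y, P (Matrix.toEuclideanLin B.transpose y) = 0)
    {K : Set (RSpace d)} (hK : IsCompact K) {g : L2Space d}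
    (hg : ∀ᵐ x, P x ∉ K → g x = 0) :
    essSupport (U g) ⊆ {x | P (Matrix.toEuclideanLin D.transpose x) ∈ K} := by
  intro x hx
  by_contra hxK
  set Q : RSpace d →ₗ[ℝ] RSpace d := P ∘ₗ Matrix.toEuclideanLin D.transpose with hQ
  obtain ⟨ε, hε, hball⟩ := Metric.isOpen_iff.mp hK.isClosed.isOpen_compl (Q x) hxK
  obtain ⟨r, hr, hrV⟩ := Metric.continuousAt_iff.mp
    Q.continuous_of_finiteDimensional.continuousAt (ε / 2) (half_pos hε)
  have h := hU.ae_eq_zero_of_isCompact P hP hK (convex_ball x r) measurableSet_ball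
    (half_pos hε) (fun k hk => ?_) (fun m hm => hrV hm) hg
  · exact hx _ (Metric.ball_mem_nhds x hr) ((ae_restrict_iff' measurableSet_ball).mpr h)
  · by_contra hlt
    rw [mul_div_cancel₀ ε two_ne_zero, not_le] at hlt
    exact hball hlt hk

end Metaplectic

/-! ### Cylinders over compact sets and their measure -/

section Cylinder

variable {d : ℕ} {L T : Submodule ℝ (RSpace d)}

theorem mem_cylinderOver_iff (h : IsCompl L T) {K : Set (RSpace d)} (hK : K ⊆ T) {x : RSpace d} :
    x ∈ cylinderOver L K ↔ T.projection L h.symm x ∈ K := by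
  constructor
  · rintro ⟨x₁, h₁, x₂, h₂, rfl⟩
    rwa [map_add, (Submodule.projection_apply_eq_zero_iff h.symm).mpr h₁, zero_add,
      Submodule.projection_apply_of_mem_left h.symm (hK h₂)]
  · intro hx
    refine ⟨x - T.projection L h.symm x, Submodule.sub_projection_mem h.symm x, _, hx, ?_⟩
    rw [sub_add_cancel]

/-- The part of the cylinder over `K` with first component in the unit ball. -/
def truncatedCylinder (h : IsCompl L T) (K : Set (RSpace d)) : Set (RSpace d) :=
  {x | T.projection L h.symm x ∈ K ∧ ‖x - T.projection L h.symm x‖ ≤ 1}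

theorem isCompact_truncatedCylinder (h : IsCompl L T) {K : Set (RSpace d)} (hK : IsCompact K) :
    IsCompact (truncatedCylinder h K) := by
  have hc : Continuous (T.projection L h.symm) :=
    (T.projection L h.symm).continuous_of_finiteDimensional
  refine Metric.isCompact_of_isClosed_isBounded ?_ ?_
  · exact (hK.isClosed.preimage hc).inter (isClosed_le (continuous_id.sub hc).norm
      continuous_const)
  · obtain ⟨R, hR⟩ := hK.isBounded.exists_norm_le
    refine (isBounded_iff_forall_norm_le).mpr ⟨1 + R, fun x hx => ?_⟩
    calc ‖x‖ = ‖(x - T.projection L h.symm x) + T.projection L h.symm x‖ := by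
          rw [sub_add_cancel]
      _ ≤ 1 + R := (norm_add_le _ _).trans (add_le_add hx.2 (hR _ hx.1))

/-- Under `T × L ≃ ℝᵈ` the product measure becomes a Haar measure, with the same null sets as
`volume`, and the cylinder pulls back to `K` times the unit ball of `L`. -/
theorem volume_truncatedCylinder_ne_zero (h : IsCompl L T) {K : Set (RSpace d)}
    (hK : IsCompact K) (hpos : 0 < subspaceLebesgue T (Subtype.val ⁻¹' K)) :
    volume (truncatedCylinder h K) ≠ 0 := by
  intro h0
  let e : (T × L) ≃L[ℝ] RSpace d :=
    (T.prodEquivOfIsCompl L h.symm).toContinuousLinearEquiv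
  have : (subspaceLebesgue T).IsAddHaarMeasure := by unfold subspaceLebesgue; infer_instance
  have : (subspaceLebesgue L).IsAddHaarMeasure := by unfold subspaceLebesgue; infer_instance
  have : (((subspaceLebesgue T).prod (subspaceLebesgue L)).map e).IsAddHaarMeasure :=
    e.isAddHaarMeasure_map _
  have hac : ((subspaceLebesgue T).prod (subspaceLebesgue L)).map e ≪ volume :=
    Measure.absolutelyContinuous_isAddHaarMeasure _ _
  have hz := hac h0
  rw [Measure.map_apply e.continuous.measurable
    (isCompact_truncatedCylinder h hK).isClosed.measurableSet] at hz
  have hpre : e ⁻¹' truncatedCylinder h K =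
      (Subtype.val ⁻¹' K : Set T) ×ˢ Metric.closedBall (0 : L) 1 := by
    ext ⟨t, l⟩
    have he : e (t, l) = (t : RSpace d) + l := rfl
    have hp : T.projection L h.symm ((t : RSpace d) + l) = t := by
      rw [map_add, Submodule.projection_apply_left, Submodule.projection_apply_right, add_zero]
    simp [truncatedCylinder, he, hp]
  rw [hpre, Measure.prod_prod, mul_eq_zero] at hz
  exact hz.elim hpos.ne' (Metric.measure_closedBall_pos _ _ one_pos).ne'

end Cylinder

theorem theorem4p6 {d : ℕ} (A B C D : Matrix (Fin d) (Fin d) ℝ)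
    (U : L2Space d ≃ₗᵢ[ℂ] L2Space d)
    (hU : IsMetaplectic (Matrix.fromBlocks A B C D) U)
    (hr1 : 1 ≤ B.rank) (hrd : B.rank < d) :
    -- the components `x₂`, `ξ₂` and the inverse of `Dᵀ` on `R(B)^⊥` are well defined
    IsCompl (matKer B)ᗮ (transComplement B D) ∧
    IsCompl (matRange B) (matRange B)ᗮ ∧
    Set.InjOn (Matrix.toEuclideanLin D.transpose) ((matRange B)ᗮ : Set (RSpace d)) ∧
    ∀ K : Set (RSpace d), IsCompact K → K ⊆ (transComplement B D : Set (RSpace d)) →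
      ∃ f : L2Space d,
        essSupport f ⊆ cylinderOver (matKer B)ᗮ K ∧
        essSupport (U f) ⊆ cylinderOver (matRange B) (transPreimage B D K) ∧
        (0 < subspaceLebesgue (transComplement B D) (Subtype.val ⁻¹' K) → f ≠ 0) := by
  have hc := isCompl_transComplement hU.1
  refine ⟨hc, Submodule.isCompl_orthogonal _,
    injOn_transpose_orthogonal_matRange hU.1, fun K hK hKT => ?_⟩
  set P := (transComplement B D).projection (matKer B)ᗮ hc.symm with hPdef
  have hPzero : ∀ x, x ∈ matRange B.transpose → P x = 0 := fun x hx =>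
    (Submodule.projection_apply_eq_zero_iff hc.symm).mpr (by rwa [orthogonal_matKer])
  have hE := isCompact_truncatedCylinder hc hK
  -- Truncation makes the set compact, hence of finite measure, so its indicator is in `L²`.
  let f : L2Space d := indicatorConstLp 2 hE.isClosed.measurableSet hE.measure_lt_top.ne (1 : ℂ)
  have hf : ∀ᵐ x, P x ∉ K → f x = 0 := by
    filter_upwards [indicatorConstLp_coeFn_notMem (p := 2) (hs := hE.isClosed.measurableSet)
      (hμs := hE.measure_lt_top.ne) (c := (1 : ℂ))] with x hx hxK
    exact hx fun hxE => hxK hxE.1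
  refine ⟨f, fun x hx => ?_, fun x hx => ?_, fun hpos hf0 => ?_⟩
  · rw [mem_cylinderOver_iff hc hKT]
    by_contra hxK
    have hopen : IsOpen (P ⁻¹' Kᶜ) :=
      hK.isClosed.isOpen_compl.preimage P.continuous_of_finiteDimensional
    exact hx _ (hopen.mem_nhds hxK) ((ae_restrict_iff' hopen.measurableSet).mpr hf)
  · have hxK := hU.essSupport_subset (P := P) (fun y => hPzero _ ⟨y, rfl⟩) hK hf hx
    obtain ⟨x₁, h₁, x₂, h₂, rfl⟩ := Submodule.exists_add_mem_mem_orthogonal (K := matRange B) x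
    refine ⟨x₁, h₁, x₂, ⟨h₂, ?_⟩, rfl⟩
    -- `P Dᵀ x₁ = 0` because `Dᵀ x₁ ∈ R(Bᵀ)`, and `P` fixes `Dᵀ x₂`.
    rwa [Set.mem_ofPred_eq, map_add, map_add,
      hPzero _ (toEuclideanLin_transpose_mem_of_mem_matRange hU.1 h₁), zero_add,
      Submodule.projection_apply_of_mem_left hc.symm (Submodule.mem_map_of_mem h₂)] at hxK
  · have hnorm := norm_indicatorConstLp (E := ℂ) (μ := (volume : Measure (RSpace d))) (p := 2) (hs := hE.isClosed.measurableSet)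
      (hμs := hE.measure_lt_top.ne) (c := (1 : ℂ)) (two_ne_zero) ENNReal.ofNat_ne_top
    rw [show indicatorConstLp 2 _ _ (1 : ℂ) = f from rfl, hf0, norm_zero, norm_one,
      one_mul] at hnorm
    have hv := volume_truncatedCylinder_ne_zero hc hK hpos
    have : 0 < volume.real (truncatedCylinder hc K) :=
      ENNReal.toReal_pos hv hE.measure_lt_top.ne
    exact (Real.rpow_pos_of_pos this _).ne hnorm
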